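/- Let $I\subseteq\mathbb R$ be an open interval containing $0$, let $f\in C^2(I)$ and $g\in C^3(I)$ be real-valued with $g(0)=0$, $g'(0)>0$ and $g(x)\neq 0$ for $x\in I\setminus\{0\}$. Consider the equation $\ddot x+f(x)\dot x^2+g(x)=0$ and set $$F(x)=\int_0^x f(s)\,ds,\qquad \mu=e^{2F},\qquad V(x)=\int_0^x\mu(s)g(s)\,ds,\qquad P=g'+gF',$$ $$N=\Big(\frac{V}{V'^2}\sqrt\mu\Big)''+\Big(\frac{V}{V'^2}(\sqrt\mu)'\Big)'\quad\text{on } I\setminus\{0\}.$$ Let $E^*>0$ be such that $\{x\in I: V(x)\le E\}$ is compact for every $E\in(0,E^*)$. The system is called isochronous if for every $E\in(0,E^*)$ the level curve $\{(x,\dot x): x\in I,\ \tfrac12\mu(x)\dot x^2+V(x)=E\}$ is a closed orbit of the equation and the minimal period of this orbit does not depend on $E$. Then: 1. The isochronicity condition $N\equiv0$ on $I\setminus\{0\}$ holds if and only if, on $I$, $$3P^2P'F'+5PP'^2-3P^2P''=0.\qquad(*)$$ 2. If $(*)$ holds on $I$, then $3P^2-gP'\neq0$ on $I$ and $g(x)e^{F(x)}+2P(x)\int_0^xe^{F(s)}\,ds\neq0$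 for all $x\in I\setminus\{0\}$. 3. If $(*)$ holds on $I$ (equivalently, if $N\equiv 0$ on $I\setminus\{0\}$), then the system is isochronous. 4. In particular, if $P\equiv1$ on $I$, that is $g'+fg=1$, then $N\equiv0$ on $I\setminus\{0\}$ and the system is isochronous. -/

import Mathlib

namespace LienardII

/-- `F(x) = ∫₀ˣ f(s) ds`, so `F' = f` wherever `f` is continuous. -/
noncomputable def primitive (f : ℝ → ℝ) (x : ℝ) : ℝ := ∫ s in (0 : ℝ)..x, f s

/-- The position dependent mass `μ = exp (2F)` (the Jacobi last multiplier). -/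
noncomputable def mass (f : ℝ → ℝ) (x : ℝ) : ℝ := Real.exp (2 * primitive f x)

/-- The potential `V(x) = ∫₀ˣ μ(s) g(s) ds`. -/
noncomputable def potential (f g : ℝ → ℝ) (x : ℝ) : ℝ :=
  ∫ s in (0 : ℝ)..x, mass f s * g s

/-- The function `N = (V / V'² · √μ)'' + (V / V'² · (√μ)')'`, meaningful where `V' ≠ 0`. -/
noncomputable def funN (f g : ℝ → ℝ) (x : ℝ) : ℝ :=
  deriv (deriv fun z =>
    potential f g z / (deriv (potential f g) z) ^ 2 * Real.sqrt (mass f z)) x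
  + deriv (fun z =>
    potential f g z / (deriv (potential f g) z) ^ 2
      * deriv (fun w => Real.sqrt (mass f w)) z) x

/-- `P = g' + g F'`, where `F' = f`. -/
noncomputable def funP (f g : ℝ → ℝ) (x : ℝ) : ℝ := deriv g x + g x * f x

/-- The condition `3 P² P' F' + 5 P P'² - 3 P² P'' = 0` at the point `x`. -/
def PCondition (f g : ℝ → ℝ) (x : ℝ) : Prop :=
  3 * (funP f g x) ^ 2 * deriv (funP f g) x * f x
    + 5 * funP f g x * (deriv (funP f g) x) ^ 2
    - 3 * (funP f g x) ^ 2 * deriv (deriv (funP f g)) x = 0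

/-- `(x, v)` is a solution, on all of `ℝ`, of `x'' + f(x) x'² + g(x) = 0` with `v = x'`. -/
def IsSolution (f g : ℝ → ℝ) (x v : ℝ → ℝ) : Prop :=
  ∀ t, HasDerivAt x (v t) t ∧ HasDerivAt v (-(f (x t) * v t ^ 2) - g (x t)) t

/-- The Hamiltonian `p² / (2μ) + V` at position `x` and velocity `v`, where `p = μ(x) v`. -/
noncomputable def energy (f g : ℝ → ℝ) (x v : ℝ) : ℝ :=
  mass f x * v ^ 2 / 2 + potential f g x

/-- The level curve of energy `E` in the phase plane, over the interval `I`. -/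
def levelCurve (f g : ℝ → ℝ) (I : Set ℝ) (E : ℝ) : Set (ℝ × ℝ) :=
  {q | q.1 ∈ I ∧ energy f g q.1 q.2 = E}

/-- The set `S` of the phase plane is a closed orbit, and `T` is the minimum time needed to
traverse it. -/
def IsClosedOrbitOfPeriod (f g : ℝ → ℝ) (S : Set (ℝ × ℝ)) (T : ℝ) : Prop :=
  ∃ x v : ℝ → ℝ, IsSolution f g x v ∧ Set.range (fun t => (x t, v t)) = S ∧
    0 < T ∧ Function.Periodic (fun t => (x t, v t)) T ∧
    ∀ T', 0 < T' → Function.Periodic (fun t => (x t, v t)) T' → T ≤ T'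

/-- Isochronicity: the level curves of energy `E ∈ (0, Estar)` are closed orbits, and their period
does not depend on `E`. -/
def IsIsochronous (f g : ℝ → ℝ) (I : Set ℝ) (Estar : ℝ) : Prop :=
  ∃ T, ∀ E ∈ Set.Ioo 0 Estar, IsClosedOrbitOfPeriod f g (levelCurve f g I E) T

end LienardII

namespace LienardII

open Set Filter Topology

/-! Write `e = exp F` and `Φ = ∫₀ˣ e`. The identity `(g e)' = P e` removes `f'` from `N`, and `N =
0` becomes the relation `2V(3P² - gP') = 3P(g e)²` (`funN_eq_zero_iff`). Differentiating this
relation and eliminating `(g e)²` gives `(*)`. Conversely, where `P > 0`, `(*)` says that `P ^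
(-2/3)` has zero second derivative with respect to `Φ`, so it is affine in `Φ`
(`rpow_funP_eq_affine`). This identity prevents `P` from reaching zero, hence `P > 0` on all of `I`
(`funP_pos`). With `s = P ^ (-1/3)` and `a = s 0`, one gets a coordinate `z` with `s = a + b z`, `Φ
= 2 a z + b z²`, `V = 2 z² / a` (`exists_quadratic_coordinate`). All quantities in the nonvanishing
claims and in the relation for `N` are then explicit. In this coordinate the energy is `2 s²
(dz/dt)² + 2 z² / a`. Putting `z = A cos θ` gives `dt = √a (a + b A cos θ) dθ`, which is Kepler's
equation. Over one turn of `θ` the term in `A` integrates to zero, so the period `2π a√a` does not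
depend on the energy. -/

/-- The standing hypotheses on the equation `x'' + f(x) x'² + g(x) = 0`: the interval `I` is open
and contains `0`, the coefficients are smooth, and `0` is the only zero of `g`. -/
structure IsCenterData (f g : ℝ → ℝ) (I : Set ℝ) : Prop where
  isOpen : IsOpen I
  ordConnected : I.OrdConnected
  zero_mem : (0 : ℝ) ∈ I
  contDiff_f : ContDiffOn ℝ 2 f I
  contDiff_g : ContDiffOn ℝ 3 g I
  g_zero : g 0 = 0
  deriv_pos : 0 < deriv g 0
  g_ne : ∀ x ∈ I, x ≠ 0 → g x ≠ 0

/-! ### Calculus on an open interval. -/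

/-- Fundamental theorem of calculus on an open interval containing `0`. -/
theorem hasDerivAt_integral_of_continuousOn {φ : ℝ → ℝ} {I : Set ℝ} (hI : IsOpen I)
    (hc : I.OrdConnected) (h0 : (0 : ℝ) ∈ I) (hφ : ContinuousOn φ I) {x : ℝ} (hx : x ∈ I) :
    HasDerivAt (fun y => ∫ s in (0 : ℝ)..y, φ s) (φ x) x := by
  have hsub : uIcc 0 x ⊆ I := hc.uIcc_subset h0 hx
  exact intervalIntegral.integral_hasDerivAt_right ((hφ.mono hsub).intervalIntegrable)
    (hφ.stronglyMeasurableAtFilter hI x hx) (hφ.continuousAt (hI.mem_nhds hx))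

/-- A function with vanishing derivative on an open interval is constant there. -/
theorem eq_of_hasDerivAt_zero {φ : ℝ → ℝ} {J : Set ℝ} (hJ : IsOpen J) (hc : IsPreconnected J)
    (hφ : ∀ x ∈ J, HasDerivAt φ 0 x) {x y : ℝ} (hx : x ∈ J) (hy : y ∈ J) : φ x = φ y :=
  hJ.is_const_of_deriv_eq_zero hc (fun z hz => (hφ z hz).differentiableAt.differentiableWithinAt)
    (fun z hz => (hφ z hz).deriv) hx hy

/-- A function with positive derivative on an open interval has a differentiable inverse. -/
theorem exists_inverse_of_hasDerivAt_pos {z z' : ℝ → ℝ} {I : Set ℝ} (hI : IsOpen I)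
    (hc : I.OrdConnected) (hz : ∀ x ∈ I, HasDerivAt z (z' x) x) (hpos : ∀ x ∈ I, 0 < z' x) :
    ∃ X : ℝ → ℝ, (∀ x ∈ I, X (z x) = x) ∧ ∀ x ∈ I, HasDerivAt X (z' x)⁻¹ (z x) := by
  have hcont : ContinuousOn z I := fun x hx => (hz x hx).continuousAt.continuousWithinAt
  have hmono : StrictMonoOn z I := by
    refine strictMonoOn_of_deriv_pos hc.convex hcont fun x hx => ?_
    have hx' := interior_subset hx
    rw [(hz x hx').deriv]
    exact hpos x hx'
  -- By monotonicity and the intermediate value theorem the image contains `[z (x - ε/2), z (x +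
  -- ε/2)]`; this yields continuity of the inverse.
  have hnhds : ∀ x ∈ I, z '' I ∈ 𝓝 (z x) := by
    intro x hx
    obtain ⟨ε, hε, hball⟩ := Metric.isOpen_iff.1 hI x hx
    have h1 : x - ε / 2 ∈ I := hball (by simp [abs_of_pos hε]; linarith)
    have h2 : x + ε / 2 ∈ I := hball (by simp [abs_of_pos hε]; linarith)
    refine mem_of_superset (Icc_mem_nhds (hmono h1 hx (by linarith)) (hmono hx h2 (by linarith))) ?_
    refine (intermediate_value_Icc (by linarith) (hcont.mono (hc.out h1 h2))).trans ?_
    exact image_mono (hc.out h1 h2)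
  let X := Function.invFunOn z I
  have hX : ∀ x ∈ I, X (z x) = x := fun x hx => hmono.injOn.leftInvOn_invFunOn hx
  have hXmono : StrictMonoOn X (z '' I) := by
    rintro _ ⟨x, hx, rfl⟩ _ ⟨y, hy, rfl⟩ hxy
    rw [hX x hx, hX y hy]
    exact (hmono.lt_iff_lt hx hy).1 hxy
  have himage : X '' (z '' I) = I := by
    rw [image_image]
    ext y
    constructor
    · rintro ⟨x, hx, rfl⟩
      simpa only [hX x hx] using hx
    · exact fun hy => ⟨y, hy, hX y hy⟩
  refine ⟨X, hX, fun x hx => ?_⟩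
  have hXc : ContinuousAt X (z x) := by
    refine hXmono.continuousAt_of_image_mem_nhds (hnhds x hx) ?_
    rw [himage, hX x hx]
    exact hI.mem_nhds hx
  refine HasDerivAt.of_local_left_inverse hXc (f := z) ?_ (hpos x hx).ne' ?_
  · rw [hX x hx]
    exact hz x hx
  · filter_upwards [hnhds x hx]
    rintro _ ⟨y, hy, rfl⟩
    rw [hX y hy]

/-! ### Regularity and signs of `g`, `P`, `Φ` and `V`. -/

variable {f g : ℝ → ℝ} {I : Set ℝ}

theorem potential_zero (f g : ℝ → ℝ) : potential f g 0 = 0 := by simp [potential]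

theorem mass_eq (f : ℝ → ℝ) (x : ℝ) : mass f x = Real.exp (primitive f x) ^ 2 := by
  rw [mass, two_mul, Real.exp_add, sq]

theorem sqrt_mass (f : ℝ → ℝ) (x : ℝ) : √(mass f x) = Real.exp (primitive f x) := by
  rw [mass_eq, Real.sqrt_sq (Real.exp_pos _).le]

namespace IsCenterData

theorem hasDerivAt_primitive (h : IsCenterData f g I) {x : ℝ} (hx : x ∈ I) :
    HasDerivAt (primitive f) (f x) x :=
  hasDerivAt_integral_of_continuousOn h.isOpen h.ordConnected h.zero_mem
    h.contDiff_f.continuousOn hx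

theorem hasDerivAt_exp (h : IsCenterData f g I) {x : ℝ} (hx : x ∈ I) :
    HasDerivAt (fun y => Real.exp (primitive f y)) (Real.exp (primitive f x) * f x) x :=
  (h.hasDerivAt_primitive hx).exp

theorem continuousOn_exp (h : IsCenterData f g I) :
    ContinuousOn (fun y => Real.exp (primitive f y)) I :=
  fun _ hx => (h.hasDerivAt_exp hx).continuousAt.continuousWithinAt

theorem hasDerivAt_arclength (h : IsCenterData f g I) {x : ℝ} (hx : x ∈ I) :
    HasDerivAt (fun y => ∫ s in (0 : ℝ)..y, Real.exp (primitive f s))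
      (Real.exp (primitive f x)) x :=
  hasDerivAt_integral_of_continuousOn h.isOpen h.ordConnected h.zero_mem h.continuousOn_exp hx

theorem hasDerivAt_potential (h : IsCenterData f g I) {x : ℝ} (hx : x ∈ I) :
    HasDerivAt (potential f g) (Real.exp (primitive f x) ^ 2 * g x) x := by
  rw [← mass_eq]
  refine hasDerivAt_integral_of_continuousOn h.isOpen h.ordConnected h.zero_mem
    (φ := fun s => mass f s * g s) ?_ hx
  simp only [mass_eq]
  exact (h.continuousOn_exp.pow 2).mul h.contDiff_g.continuousOn

/-- Written through `P` so that `f` cancels in `(g e)' = P e`. -/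
theorem hasDerivAt_g (h : IsCenterData f g I) {x : ℝ} (hx : x ∈ I) :
    HasDerivAt g (funP f g x - g x * f x) x := by
  have := ((h.contDiff_g.contDiffAt (h.isOpen.mem_nhds hx)).differentiableAt
    (by norm_num)).hasDerivAt
  simpa [funP] using this

theorem contDiffOn_funP (h : IsCenterData f g I) : ContDiffOn ℝ 2 (funP f g) I :=
  (h.contDiff_g.deriv_of_isOpen h.isOpen (by norm_num)).add
    ((h.contDiff_g.of_le (by norm_num)).mul h.contDiff_f)

theorem hasDerivAt_funP (h : IsCenterData f g I) {x : ℝ} (hx : x ∈ I) :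
    HasDerivAt (funP f g) (deriv (funP f g) x) x :=
  ((h.contDiffOn_funP.contDiffAt (h.isOpen.mem_nhds hx)).differentiableAt (by norm_num)).hasDerivAt

theorem contDiffOn_deriv_funP (h : IsCenterData f g I) :
    ContDiffOn ℝ 1 (deriv (funP f g)) I :=
  h.contDiffOn_funP.deriv_of_isOpen h.isOpen (by norm_num)

theorem hasDerivAt_deriv_funP (h : IsCenterData f g I) {x : ℝ} (hx : x ∈ I) :
    HasDerivAt (deriv (funP f g)) (deriv (deriv (funP f g)) x) x :=
  ((h.contDiffOn_deriv_funP.contDiffAt (h.isOpen.mem_nhds hx)).differentiableAt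
    (by norm_num)).hasDerivAt

theorem continuousOn_deriv_deriv_funP (h : IsCenterData f g I) :
    ContinuousOn (deriv (deriv (funP f g))) I :=
  (h.contDiffOn_deriv_funP.deriv_of_isOpen h.isOpen (m := 0) (by norm_num)).continuousOn

theorem funP_zero_pos (h : IsCenterData f g I) : 0 < funP f g 0 := by
  simpa [funP, h.g_zero] using h.deriv_pos

/-- The function `g` has the sign of its argument. -/
theorem mul_g_pos (h : IsCenterData f g I) {x : ℝ} (hx : x ∈ I) (hx0 : x ≠ 0) : 0 < x * g x := by
  have hd : HasDerivAt g (deriv g 0) 0 :=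
    ((h.contDiff_g.contDiffAt (h.isOpen.mem_nhds h.zero_mem)).differentiableAt
      (by norm_num)).hasDerivAt
  -- Near `0` the quotient `g y / y` is close to `g' 0 > 0`. A wrong sign at `x` would then produce
  -- a second zero of `g` by the intermediate value theorem.
  have hslope := hd.tendsto_slope.eventually (lt_mem_nhds h.deriv_pos)
  have hsign : ∀ᶠ y in 𝓝[≠] (0 : ℝ), 0 < y * g y := by
    filter_upwards [hslope, self_mem_nhdsWithin] with y hy hy0
    rw [slope_def_field, h.g_zero, sub_zero, sub_zero] at hy
    have hy0' : y ≠ 0 := hy0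
    have : y * g y = g y / y * y ^ 2 := by field_simp
    rw [this]
    positivity
  have hcont := h.contDiff_g.continuousOn
  by_contra hneg
  rcases lt_or_gt_of_ne hx0 with hlt | hgt
  · have hgx : 0 < g x := by
      have : g x ≠ 0 := h.g_ne x hx hx0
      rcases lt_or_gt_of_ne this with h1 | h1
      · exact absurd (mul_pos_of_neg_of_neg hlt h1) hneg
      · exact h1
    have hev : ∀ᶠ y in 𝓝[<] (0 : ℝ), 0 < y * g y ∧ y ∈ Ioo x 0 :=
      (hsign.filter_mono (nhdsWithin_mono _ fun y hy => ne_of_lt hy)).and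
        (Ioo_mem_nhdsLT hlt)
    obtain ⟨y, hy, hxy, hy0⟩ := hev.exists
    have hgy : g y < 0 := by nlinarith
    have hyI : y ∈ I := h.ordConnected.out hx h.zero_mem ⟨hxy.le, hy0.le⟩
    obtain ⟨c, hc, hgc⟩ := intermediate_value_Icc' hxy.le
      (hcont.mono (h.ordConnected.out hx hyI)) ⟨hgy.le, hgx.le⟩
    exact h.g_ne c (h.ordConnected.out hx hyI hc) (by linarith [hc.2]) hgc
  · have hgx : g x < 0 := by
      have : g x ≠ 0 := h.g_ne x hx hx0
      rcases lt_or_gt_of_ne this with h1 | h1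
      · exact h1
      · exact absurd (mul_pos hgt h1) hneg
    have hev : ∀ᶠ y in 𝓝[>] (0 : ℝ), 0 < y * g y ∧ y ∈ Ioo 0 x :=
      (hsign.filter_mono (nhdsWithin_mono _ fun y hy => ne_of_gt hy)).and
        (Ioo_mem_nhdsGT hgt)
    obtain ⟨y, hy, hy0, hxy⟩ := hev.exists
    have hgy : 0 < g y := by nlinarith
    have hyI : y ∈ I := h.ordConnected.out h.zero_mem hx ⟨hy0.le, hxy.le⟩
    obtain ⟨c, hc, hgc⟩ := intermediate_value_Icc' hxy.le
      (hcont.mono (h.ordConnected.out hyI hx)) ⟨hgx.le, hgy.le⟩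
    exact h.g_ne c (h.ordConnected.out hyI hx hc) (by linarith [hc.1]) hgc

theorem mul_arclength_pos (h : IsCenterData f g I) {x : ℝ} (hx : x ∈ I) (hx0 : x ≠ 0) :
    0 < x * ∫ s in (0 : ℝ)..x, Real.exp (primitive f s) := by
  have hint : ∀ a ∈ I, ∀ b ∈ I, IntervalIntegrable (fun s => Real.exp (primitive f s))
      MeasureTheory.volume a b := fun a ha b hb =>
    (h.continuousOn_exp.mono (h.ordConnected.uIcc_subset ha hb)).intervalIntegrable
  rcases lt_or_gt_of_ne hx0 with hlt | hgt
  · rw [intervalIntegral.integral_symm]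
    have := intervalIntegral.intervalIntegral_pos_of_pos (hint x hx 0 h.zero_mem)
      (fun s => Real.exp_pos _) hlt
    nlinarith
  · exact mul_pos hgt (intervalIntegral.intervalIntegral_pos_of_pos (hint 0 h.zero_mem x hx)
      (fun s => Real.exp_pos _) hgt)

/-- The potential is positive away from the center. -/
theorem potential_pos (h : IsCenterData f g I) {x : ℝ} (hx : x ∈ I) (hx0 : x ≠ 0) :
    0 < potential f g x := by
  have hcont : ContinuousOn (potential f g) I :=
    fun y hy => (h.hasDerivAt_potential hy).continuousAt.continuousWithinAt
  rcases lt_or_gt_of_ne hx0 with hlt | hgt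
  · have hsub : Icc x 0 ⊆ I := h.ordConnected.out hx h.zero_mem
    have := strictAntiOn_of_deriv_neg (convex_Icc x 0) (hcont.mono hsub) fun y hy => by
      rw [interior_Icc] at hy
      have hyI := hsub (Ioo_subset_Icc_self hy)
      rw [(h.hasDerivAt_potential hyI).deriv]
      have hg : g y < 0 := by nlinarith [h.mul_g_pos hyI hy.2.ne, hy.2]
      exact mul_neg_of_pos_of_neg (by positivity) hg
    simpa [potential_zero] using this (left_mem_Icc.2 hlt.le) (right_mem_Icc.2 hlt.le) hlt
  · have hsub : Icc 0 x ⊆ I := h.ordConnected.out h.zero_mem hx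
    have := strictMonoOn_of_deriv_pos (convex_Icc 0 x) (hcont.mono hsub) fun y hy => by
      rw [interior_Icc] at hy
      have hyI := hsub (Ioo_subset_Icc_self hy)
      rw [(h.hasDerivAt_potential hyI).deriv]
      have hg : 0 < g y := by nlinarith [h.mul_g_pos hyI hy.1.ne', hy.1]
      positivity
    simpa [potential_zero] using this (left_mem_Icc.2 hgt.le) (right_mem_Icc.2 hgt.le) hgt

/-! ### The function `N`, and the passage from `N = 0` to `(*)`. -/

/-- Closed form of `N` away from the center. -/
theorem funN_eq (h : IsCenterData f g I) {x : ℝ} (hx : x ∈ I) (hx0 : x ≠ 0) :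
    funN f g x = Real.exp (primitive f x)
      * (2 * potential f g x * (3 * funP f g x ^ 2 - g x * deriv (funP f g) x)
        - 3 * funP f g x * (g x * Real.exp (primitive f x)) ^ 2)
      / (g x * Real.exp (primitive f x)) ^ 4 := by
  set e : ℝ → ℝ := fun y => Real.exp (primitive f y) with he
  set V := potential f g with hV
  set P := funP f g with hP
  have hepos : ∀ y, 0 < e y := fun y => Real.exp_pos _
  have hU : I \ {0} ∈ 𝓝 x := (h.isOpen.sdiff isClosed_singleton).mem_nhds ⟨hx, hx0⟩
  have hmem : ∀ y ∈ I \ {0}, I \ {0} ∈ 𝓝 y :=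
    fun y hy => (h.isOpen.sdiff isClosed_singleton).mem_nhds hy
  have hgne : ∀ y ∈ I \ {0}, g y ≠ 0 := fun y hy => h.g_ne y hy.1 hy.2
  have hde : ∀ y ∈ I, HasDerivAt e (e y * f y) y := fun y hy => h.hasDerivAt_exp hy
  have hdV : ∀ y ∈ I, HasDerivAt V (e y ^ 2 * g y) y := fun y hy => h.hasDerivAt_potential hy
  have hdg : ∀ y ∈ I, HasDerivAt g (P y - g y * f y) y := fun y hy => h.hasDerivAt_g hy
  have hsq : (fun w => √(mass f w)) = e := funext fun w => sqrt_mass f w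
  have hdf : DifferentiableAt ℝ f x :=
    (h.contDiff_f.contDiffAt (h.isOpen.mem_nhds hx)).differentiableAt (by norm_num)
  -- `B` is the bracket in the second summand of `N`, and the inner derivative in the first summand
  -- is `G - B`. Hence `B'` cancels and `N = G'`.
  let B : ℝ → ℝ := fun z => V z / (e z ^ 2 * g z) ^ 2 * (e z * f z)
  let G : ℝ → ℝ := fun z => ((g z * e z) ^ 2 - 2 * V z * P z) / (g z * e z) ^ 3
  have hq : ∀ y ∈ I \ {0}, e y ^ 2 * g y ≠ 0 :=
    fun y hy => mul_ne_zero (pow_ne_zero _ (hepos y).ne') (hgne y hy)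
  have hfirst : ∀ y ∈ I \ {0},
      deriv (fun z => V z / (deriv V z) ^ 2 * √(mass f z)) y = G y - B y := by
    intro y hy
    have hev : (fun z => V z / (deriv V z) ^ 2 * √(mass f z)) =ᶠ[𝓝 y]
        fun z => V z / (e z ^ 2 * g z) ^ 2 * e z := by
      filter_upwards [hmem y hy] with z hz
      rw [(hdV z hz.1).deriv, sqrt_mass]
    rw [hev.deriv_eq]
    have hD := ((hdV y hy.1).fun_div ((((hde y hy.1).fun_pow 2).fun_mul (hdg y hy.1)).fun_pow 2)
      (pow_ne_zero 2 (hq y hy))).fun_mul (hde y hy.1)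
    rw [hD.deriv]
    have h1 := hgne y hy
    have h2 := (hepos y).ne'
    simp only [G, B]
    field_simp
    ring
  have hsecond : (fun z => V z / (deriv V z) ^ 2 * deriv (fun w => √(mass f w)) z) =ᶠ[𝓝 x] B := by
    filter_upwards [hU] with z hz
    rw [(hdV z hz.1).deriv, hsq, (hde z hz.1).deriv]
  have hBd : DifferentiableAt ℝ B x := by
    have := (((hdV x hx).fun_div ((((hde x hx).fun_pow 2).fun_mul (hdg x hx)).fun_pow 2)
      (pow_ne_zero 2 (hq x ⟨hx, hx0⟩))).differentiableAt).fun_mul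
      ((hde x hx).differentiableAt.fun_mul hdf)
    exact this
  have h1 := hgne x ⟨hx, hx0⟩
  have h2 := (hepos x).ne'
  have hgd := (hdg x hx).fun_mul (hde x hx)
  have hGd := ((hgd.fun_pow 2).fun_sub
    (((hdV x hx).const_mul 2).fun_mul (h.hasDerivAt_funP hx))).fun_div (hgd.fun_pow 3)
    (pow_ne_zero 3 (mul_ne_zero h1 h2))
  have hev : deriv (fun z => V z / (deriv V z) ^ 2 * √(mass f z)) =ᶠ[𝓝 x] fun y => G y - B y := by
    filter_upwards [hU] with y hy
    exact hfirst y hy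
  have hGB : deriv (fun y => G y - B y) x = deriv G x - deriv B x :=
    deriv_fun_sub hGd.differentiableAt hBd
  rw [funN, hev.deriv_eq, hsecond.deriv_eq, hGB, sub_add_cancel, hGd.deriv, ← hP]
  change _ = e x * (2 * V x * (3 * P x ^ 2 - g x * deriv P x) - 3 * P x * (g x * e x) ^ 2)
    / (g x * e x) ^ 4
  field_simp
  ring

/-- The vanishing of `N` as an algebraic relation between `V`, `P`, `P'` and `g`. -/
theorem funN_eq_zero_iff (h : IsCenterData f g I) {x : ℝ} (hx : x ∈ I) (hx0 : x ≠ 0) :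
    funN f g x = 0 ↔
      2 * potential f g x * (3 * funP f g x ^ 2 - g x * deriv (funP f g) x)
        = 3 * funP f g x * (g x * Real.exp (primitive f x)) ^ 2 := by
  have he := (Real.exp_pos (primitive f x)).ne'
  rw [h.funN_eq hx hx0, div_eq_zero_iff, or_iff_left (pow_ne_zero 4 (mul_ne_zero
    (h.g_ne x hx hx0) he)), mul_eq_zero, or_iff_right he, sub_eq_zero]

theorem pCondition_of_funN_eq_zero (h : IsCenterData f g I)
    (hN : ∀ x ∈ I, x ≠ 0 → funN f g x = 0) {x : ℝ} (hx : x ∈ I) : PCondition f g x := by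
  have hoff : ∀ y ∈ I \ {0}, PCondition f g y := by
    intro y hy
    have hgy := h.g_ne y hy.1 hy.2
    have hVy := (h.potential_pos hy.1 hy.2).ne'
    have hP := h.hasDerivAt_funP hy.1
    have hg := h.hasDerivAt_g hy.1
    have hl := ((h.hasDerivAt_potential hy.1).const_mul 2).fun_mul
      (((hP.fun_pow 2).const_mul 3).fun_sub (hg.fun_mul (h.hasDerivAt_deriv_funP hy.1)))
    have hr := (hP.const_mul 3).fun_mul ((hg.fun_mul (h.hasDerivAt_exp hy.1)).fun_pow 2)
    have hev : (fun z => 2 * potential f g z * (3 * funP f g z ^ 2 - g z * deriv (funP f g) z))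
        =ᶠ[𝓝 y] fun z => 3 * funP f g z * (g z * Real.exp (primitive f z)) ^ 2 := by
      filter_upwards [(h.isOpen.sdiff isClosed_singleton).mem_nhds hy] with z hz
      exact (h.funN_eq_zero_iff hz.1 hz.2).1 (hN z hz.1 hz.2)
    have key := hl.unique (hr.congr_of_eventuallyEq hev)
    have hA := (h.funN_eq_zero_iff hy.1 hy.2).1 (hN y hy.1 hy.2)
    rw [PCondition]
    generalize Real.exp (primitive f y) = e at *
    generalize potential f g y = V at *
    generalize funP f g y = P at *
    generalize deriv (deriv (funP f g)) y = P'' at *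
    generalize deriv (funP f g) y = P' at *
    norm_num at key
    -- The differentiated relation: the terms `6 P² g e²` on its two sides cancel. Combining it with
    -- the relation itself eliminates `(g e)²` and leaves a multiple of `V g`, which is nonzero off
    -- the center.
    have h1 : 2 * V * (5 * P * P' + g y * f y * P' - g y * P'') = 5 * P' * (g y * e) ^ 2 := by
      linear_combination key
    have h2 : V * g y * (3 * P * P' * f y - 3 * P * P'' + 5 * P' ^ 2) = 0 := by
      linear_combination (3 / 2) * P * h1 - (5 / 2) * P' * hA
    rcases mul_eq_zero.1 h2 with h3 | h3
    · exact absurd h3 (mul_ne_zero hVy hgy)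
    · linear_combination P * h3
  -- At the center the condition follows by continuity, `P` being of class `C²`.
  by_cases hx0 : x = 0
  · have hIx := h.isOpen.mem_nhds hx
    have cP := (h.contDiffOn_funP.continuousOn).continuousAt hIx
    have cP' := (h.contDiffOn_deriv_funP.continuousOn).continuousAt hIx
    have cP'' := h.continuousOn_deriv_deriv_funP.continuousAt hIx
    have cf := h.contDiff_f.continuousOn.continuousAt hIx
    have hc : ContinuousAt (fun x => 3 * (funP f g x) ^ 2 * deriv (funP f g) x * f x
        + 5 * funP f g x * (deriv (funP f g) x) ^ 2
        - 3 * (funP f g x) ^ 2 * deriv (deriv (funP f g)) x) x :=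
      (((((cP.pow 2).const_mul 3).mul cP').mul cf).add ((cP.const_mul 5).mul (cP'.pow 2))).sub
        (((cP.pow 2).const_mul 3).mul cP'')
    refine tendsto_nhds_unique (hc.tendsto.mono_left (nhdsWithin_le_nhds (s := {x}ᶜ))) ?_
    refine tendsto_const_nhds.congr' ?_
    filter_upwards [nhdsWithin_le_nhds hIx, self_mem_nhdsWithin] with y hy hyx
    exact (hoff y ⟨hy, fun h0 => hyx (h0.trans hx0.symm)⟩).symm
  · exact hoff x ⟨hx, hx0⟩

/-! ### Consequences of `(*)`: positivity of `P` and the quadratic coordinate. -/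

/-- On a preconnected open set around `0` where `P > 0`, the condition `(*)` says that
`P ^ (-2/3)` is an affine function of `∫₀ˣ exp F`. -/
theorem rpow_funP_eq_affine (h : IsCenterData f g I) (hC : ∀ x ∈ I, PCondition f g x)
    {J : Set ℝ} (hJ : IsOpen J) (hJc : IsPreconnected J) (hJI : J ⊆ I) (h0 : (0 : ℝ) ∈ J)
    (hpos : ∀ x ∈ J, 0 < funP f g x) : ∃ b : ℝ, ∀ x ∈ J,
      funP f g x ^ (-(2 / 3) : ℝ)
        = funP f g 0 ^ (-(2 / 3) : ℝ) + b * ∫ s in (0 : ℝ)..x, Real.exp (primitive f s) := by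
  -- `C` is the derivative of `P ^ (-2/3)` with respect to `Φ`, that is `exp (-F) d/dx`; its own
  -- derivative vanishes by `(*)` divided by `P`.
  let C : ℝ → ℝ := fun x =>
    -(2 / 3) * deriv (funP f g) x * funP f g x ^ (-(5 / 3) : ℝ) * Real.exp (-primitive f x)
  have hdC : ∀ x ∈ J, HasDerivAt C 0 x := by
    intro x hx
    have hxI := hJI hx
    have hP := h.hasDerivAt_funP hxI
    have hD := (((h.hasDerivAt_deriv_funP hxI).const_mul (-(2 / 3))).fun_mul
      (hP.rpow_const (p := -(5 / 3)) (Or.inl (hpos x hx).ne'))).fun_mul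
      ((h.hasDerivAt_primitive hxI).fun_neg.exp)
    refine hD.congr_deriv ?_
    have hcond := hC x hxI
    rw [PCondition] at hcond
    have hp := hpos x hx
    have hexp : funP f g x ^ (-(5 / 3) : ℝ) = funP f g x ^ (-(5 / 3) - 1 : ℝ) * funP f g x := by
      rw [← Real.rpow_add_one hp.ne']
      norm_num
    rw [hexp]
    have hk : 3 * funP f g x * deriv (funP f g) x * f x + 5 * deriv (funP f g) x ^ 2
        - 3 * funP f g x * deriv (deriv (funP f g)) x = 0 := by
      refine (mul_eq_zero.1 (?_ : funP f g x * _ = 0)).resolve_left hp.ne'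
      linear_combination hcond
    linear_combination (2 / 9) * funP f g x ^ (-(5 / 3) - 1 : ℝ) * Real.exp (-primitive f x) * hk
  refine ⟨C 0, fun x hx => ?_⟩
  have hdQ : ∀ y ∈ J, HasDerivAt (fun z => funP f g z ^ (-(2 / 3) : ℝ)
      - C 0 * ∫ s in (0 : ℝ)..z, Real.exp (primitive f s)) 0 y := by
    intro y hy
    have hD := ((h.hasDerivAt_funP (hJI hy)).rpow_const (p := -(2 / 3))
      (Or.inl (hpos y hy).ne')).fun_sub ((h.hasDerivAt_arclength (hJI hy)).const_mul (C 0))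
    refine hD.congr_deriv ?_
    rw [eq_of_hasDerivAt_zero hJ hJc hdC h0 hy]
    have hexp : (-(2 / 3) - 1 : ℝ) = -(5 / 3) := by norm_num
    have hcancel : Real.exp (-primitive f y) * Real.exp (primitive f y) = 1 := by
      rw [← Real.exp_add, neg_add_cancel, Real.exp_zero]
    simp only [C, hexp]
    linear_combination (2 / 3) * deriv (funP f g) y * funP f g y ^ (-(5 / 3) : ℝ) * hcancel
  have := eq_of_hasDerivAt_zero hJ hJc hdQ hx h0
  simp only [intervalIntegral.integral_same, mul_zero, sub_zero] at this
  linarith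

/-- Under `(*)` the function `P` is positive. -/
theorem funP_pos (h : IsCenterData f g I) (hC : ∀ x ∈ I, PCondition f g x) {x : ℝ} (hx : x ∈ I) :
    0 < funP f g x := by
  have hPc := h.contDiffOn_funP.continuousOn
  let U : Set ℝ := I ∩ funP f g ⁻¹' Ioi 0
  have hU : IsOpen U := hPc.isOpen_inter_preimage h.isOpen isOpen_Ioi
  have h0U : (0 : ℝ) ∈ U := ⟨h.zero_mem, h.funP_zero_pos⟩
  let J := connectedComponentIn U 0
  have hJ : IsOpen J := hU.connectedComponentIn
  have hJU : J ⊆ U := connectedComponentIn_subset U 0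
  have h0J : (0 : ℝ) ∈ J := mem_connectedComponentIn h0U
  have hJc : IsPreconnected J := isPreconnected_connectedComponentIn
  obtain ⟨b, hb⟩ := h.rpow_funP_eq_affine hC hJ hJc (fun y hy => (hJU hy).1) h0J
    (fun y hy => (hJU hy).2)
  -- `J` is relatively closed in `I`: the identity `P ^ (2/3) * (affine in Φ) = 1` passes to the
  -- limit, where `P c = 0` would give `0 = 1`. So `c` can be added to the component.
  have hclos : closure J ∩ I ⊆ J := by
    rintro c ⟨hcJ, hcI⟩
    have hcont := hPc.continuousAt (h.isOpen.mem_nhds hcI)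
    have hne : (𝓝[J] c).NeBot := mem_closure_iff_nhdsWithin_neBot.1 hcJ
    have hlim : Tendsto (fun y => funP f g y ^ (2 / 3 : ℝ) * (funP f g 0 ^ (-(2 / 3) : ℝ)
        + b * ∫ s in (0 : ℝ)..y, Real.exp (primitive f s))) (𝓝[J] c)
        (𝓝 (funP f g c ^ (2 / 3 : ℝ) * (funP f g 0 ^ (-(2 / 3) : ℝ)
        + b * ∫ s in (0 : ℝ)..c, Real.exp (primitive f s)))) := by
      refine Tendsto.mono_left ?_ nhdsWithin_le_nhds
      exact ((hcont.rpow_const (Or.inr (by norm_num))).mul (continuousAt_const.add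
        ((h.hasDerivAt_arclength hcI).continuousAt.const_mul b))).tendsto
    have hone : Tendsto (fun y => funP f g y ^ (2 / 3 : ℝ) * (funP f g 0 ^ (-(2 / 3) : ℝ)
        + b * ∫ s in (0 : ℝ)..y, Real.exp (primitive f s))) (𝓝[J] c) (𝓝 1) := by
      refine tendsto_const_nhds.congr' ?_
      filter_upwards [self_mem_nhdsWithin] with y hy
      rw [← hb y hy, ← Real.rpow_add (hJU hy).2]
      norm_num
    have hprod := tendsto_nhds_unique hlim hone
    have hnonneg : 0 ≤ funP f g c :=
      ge_of_tendsto (hcont.tendsto.mono_left nhdsWithin_le_nhds)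
        (by filter_upwards [self_mem_nhdsWithin] with y hy using (hJU hy).2.le)
    have hcpos : 0 < funP f g c := by
      refine hnonneg.lt_of_ne fun hz => ?_
      rw [← hz, Real.zero_rpow (by norm_num), zero_mul] at hprod
      exact zero_ne_one hprod
    have hsub : insert c J ⊆ J := by
      refine IsPreconnected.subset_connectedComponentIn (x := 0)
        (hJc.subset_closure (subset_insert c J) (insert_subset hcJ subset_closure))
        (mem_insert_of_mem c h0J) (insert_subset ⟨hcI, hcpos⟩ hJU)
    exact hsub (mem_insert c J)
  have hIJ : I ⊆ J := h.ordConnected.isPreconnected.subset_of_closure_inter_subset hJ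
    ⟨0, h.zero_mem, h0J⟩ hclos
  exact (hJU (hIJ hx)).2

/-- Under `(*)` there is a coordinate `z` on `I` in which the potential is quadratic, the arclength
parameter `∫₀ˣ exp F` being a quadratic polynomial of `z`. -/
theorem exists_quadratic_coordinate (h : IsCenterData f g I) (hC : ∀ x ∈ I, PCondition f g x) :
    ∃ (a b : ℝ) (z : ℝ → ℝ), 0 < a ∧ z 0 = 0 ∧ ∀ x ∈ I,
      0 < a + b * z x ∧
      HasDerivAt z (Real.exp (primitive f x) / (2 * (a + b * z x))) x ∧
      funP f g x * (a + b * z x) ^ 3 = 1 ∧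
      g x * Real.exp (primitive f x) * (a * (a + b * z x)) = 2 * z x ∧
      a * potential f g x = 2 * z x ^ 2 := by
  have hP := fun x (hx : x ∈ I) => h.funP_pos hC hx
  have hpre := h.ordConnected.isPreconnected
  obtain ⟨b, hb⟩ := h.rpow_funP_eq_affine hC h.isOpen hpre le_rfl h.zero_mem hP
  let s : ℝ → ℝ := fun x => funP f g x ^ (-(1 / 3) : ℝ)
  let Φ : ℝ → ℝ := fun x => ∫ s in (0 : ℝ)..x, Real.exp (primitive f s)
  have hs : ∀ x ∈ I, 0 < s x := fun x hx => Real.rpow_pos_of_pos (hP x hx) _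
  have hs2 : ∀ x ∈ I, s x ^ 2 = funP f g x ^ (-(2 / 3) : ℝ) := by
    intro x hx
    rw [← Real.rpow_natCast, ← Real.rpow_mul (hP x hx).le]
    norm_num
  have hs3 : ∀ x ∈ I, funP f g x * s x ^ 3 = 1 := by
    intro x hx
    rw [← Real.rpow_natCast (s x), ← Real.rpow_mul (hP x hx).le]
    norm_num
    rw [Real.rpow_neg_one]
    exact mul_inv_cancel₀ (hP x hx).ne'
  have ha : 0 < s 0 := hs 0 h.zero_mem
  have haff : ∀ x ∈ I, s x ^ 2 = s 0 ^ 2 + b * Φ x := by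
    intro x hx
    rw [hs2 x hx, hs2 0 h.zero_mem]
    exact hb x hx
  -- This is `(s - s 0) / b` in rationalised form, so that `b = 0` needs no separate case.
  let z : ℝ → ℝ := fun x => Φ x / (s x + s 0)
  have hsz : ∀ x ∈ I, s x = s 0 + b * z x := by
    intro x hx
    have := hs x hx
    have h1 : s x + s 0 ≠ 0 := by positivity
    simp only [z]
    field_simp
    linear_combination haff x hx
  have hds : ∀ x ∈ I, HasDerivAt s (b * Real.exp (primitive f x) / (2 * s x)) x := by
    intro x hx
    have hx' := (hs x hx).ne'
    have hsd : HasDerivAt s (deriv s x) x := ((h.hasDerivAt_funP hx).rpow_const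
      (p := -(1 / 3)) (Or.inl (hP x hx).ne')).differentiableAt.hasDerivAt
    have h1 := hsd.fun_pow 2
    have h2 : HasDerivAt (fun y => s 0 ^ 2 + b * Φ y) (b * Real.exp (primitive f x)) x :=
      ((h.hasDerivAt_arclength hx).const_mul b).const_add _
    have hev : (fun y => s y ^ 2) =ᶠ[𝓝 x] fun y => s 0 ^ 2 + b * Φ y := by
      filter_upwards [h.isOpen.mem_nhds hx] with y hy using haff y hy
    have h3 := h1.unique (h2.congr_of_eventuallyEq hev)
    norm_num at h3
    refine hsd.congr_deriv ?_
    field_simp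
    linear_combination h3
  have hdz : ∀ x ∈ I, HasDerivAt z (Real.exp (primitive f x) / (2 * s x)) x := by
    intro x hx
    have hsx := hs x hx
    have h1 : s x + s 0 ≠ 0 := by positivity
    refine ((h.hasDerivAt_arclength hx).fun_div ((hds x hx).add_const (s 0)) h1).congr_deriv ?_
    have := haff x hx
    change (Real.exp (primitive f x) * (s x + s 0)
      - Φ x * (b * Real.exp (primitive f x) / (2 * s x))) / (s x + s 0) ^ 2 = _
    field_simp
    linear_combination this
  have hz0 : z 0 = 0 := by simp [z, Φ]
  -- Both sides vanish at `0` and have derivative `P e`, because `s - b z = s 0` and `P s³ = 1`.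
  have hh : ∀ x ∈ I, g x * Real.exp (primitive f x) = 2 * z x / (s 0 * s x) := by
    have hd : ∀ x ∈ I, HasDerivAt (fun y => g y * Real.exp (primitive f y)
        - 2 * z y / (s 0 * s y)) 0 x := by
      intro x hx
      have hsx := hs x hx
      refine (((h.hasDerivAt_g hx).fun_mul (h.hasDerivAt_exp hx)).fun_sub
        (((hdz x hx).const_mul 2).fun_div ((hds x hx).const_mul (s 0))
          (mul_pos ha hsx).ne')).congr_deriv ?_
      have h1 := hsz x hx
      have h2 := hs3 x hx
      field_simp
      linear_combination Real.exp (primitive f x) * (s 0 * h2 - h1)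
    intro x hx
    have := eq_of_hasDerivAt_zero h.isOpen hpre hd hx h.zero_mem
    simp only [h.g_zero, hz0, zero_mul, mul_zero, zero_div, sub_zero] at this
    linarith
  have hV : ∀ x ∈ I, s 0 * potential f g x = 2 * z x ^ 2 := by
    have hd : ∀ x ∈ I, HasDerivAt (fun y => s 0 * potential f g y - 2 * z y ^ 2) 0 x := by
      intro x hx
      have hsx := hs x hx
      refine (((h.hasDerivAt_potential hx).const_mul (s 0)).fun_sub
        (((hdz x hx).fun_pow 2).const_mul 2)).congr_deriv ?_
      have h1 := hh x hx
      field_simp at h1 ⊢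
      norm_num
      linear_combination h1
    intro x hx
    have := eq_of_hasDerivAt_zero h.isOpen hpre hd hx h.zero_mem
    simp only [potential_zero, hz0, mul_zero] at this
    norm_num at this
    linarith
  refine ⟨s 0, b, z, ha, hz0, fun x hx => ?_⟩
  rw [← hsz x hx]
  have hsx := hs x hx
  refine ⟨hsx, hdz x hx, hs3 x hx, ?_, hV x hx⟩
  rw [hh x hx]
  field_simp

/-- Differentiating `P s³ = 1` expresses `P'` through `s = a + b z`, and the difference becomes `3 /
(a s⁵)`. The second conjunct is the criterion of `funN_eq_zero_iff`, hence gives `N = 0` from `(*)`.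
-/
theorem three_mul_sq_sub_pos (h : IsCenterData f g I) (hC : ∀ x ∈ I, PCondition f g x)
    {x : ℝ} (hx : x ∈ I) :
    0 < 3 * funP f g x ^ 2 - g x * deriv (funP f g) x ∧
      2 * potential f g x * (3 * funP f g x ^ 2 - g x * deriv (funP f g) x)
        = 3 * funP f g x * (g x * Real.exp (primitive f x)) ^ 2 := by
  obtain ⟨a, b, z, ha, -, hz⟩ := h.exists_quadratic_coordinate hC
  obtain ⟨hs, hdz, hP3, hg, hV⟩ := hz x hx
  have hP := h.funP_pos hC hx
  have hev : (fun y => funP f g y * (a + b * z y) ^ 3) =ᶠ[𝓝 x] fun _ => 1 := by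
    filter_upwards [h.isOpen.mem_nhds hx] with y hy using (hz y hy).2.2.1
  have hd := ((h.hasDerivAt_funP hx).fun_mul
    (((hdz.const_mul b).const_add a).fun_pow 3)).unique
    ((hasDerivAt_const x (1 : ℝ)).congr_of_eventuallyEq hev)
  have hsz : b * z x = a + b * z x - a := by ring
  set s := a + b * z x with hs_def
  have hV' : potential f g x = 2 * z x ^ 2 / a := by
    field_simp
    linear_combination hV
  have hg' : g x * Real.exp (primitive f x) = 2 * z x / (a * s) := by
    field_simp
    linear_combination hg
  have hP' : deriv (funP f g) x
      = -(3 * b * Real.exp (primitive f x) * funP f g x) / (2 * s ^ 2) := by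
    norm_num at hd
    field_simp at hd ⊢
    have hd' := (mul_eq_zero.1 (hd.trans (mul_zero 2))).resolve_left hs.ne'
    linear_combination hd'
  have hgP' : g x * deriv (funP f g) x = -(3 * funP f g x * (s - a)) / (a * s ^ 3) := by
    rw [hP', ← hsz]
    have : g x * (-(3 * b * Real.exp (primitive f x) * funP f g x) / (2 * s ^ 2))
        = -(3 * b * funP f g x) / (2 * s ^ 2) * (g x * Real.exp (primitive f x)) := by ring
    rw [this, hg']
    field_simp
  have hinv : funP f g x = 1 / s ^ 3 := by
    field_simp
    linear_combination hP3
  have hval : 3 * funP f g x ^ 2 - g x * deriv (funP f g) x = 3 / (a * s ^ 5) := by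
    rw [hgP', hinv]
    field_simp
    ring
  rw [hval]
  refine ⟨by positivity, ?_⟩
  rw [hV', hg', hinv]
  field_simp

theorem funN_eq_zero_iff_pCondition (h : IsCenterData f g I) :
    (∀ x ∈ I, x ≠ 0 → funN f g x = 0) ↔ ∀ x ∈ I, PCondition f g x :=
  ⟨fun hN _ hx => h.pCondition_of_funN_eq_zero hN hx, fun hC _ hx hx0 =>
    (h.funN_eq_zero_iff hx hx0).2 (h.three_mul_sq_sub_pos hC hx).2⟩

/-- Since `P > 0`, both summands have the sign of `x`. -/
theorem mul_exp_add_ne_zero (h : IsCenterData f g I) (hC : ∀ x ∈ I, PCondition f g x)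
    {x : ℝ} (hx : x ∈ I) (hx0 : x ≠ 0) :
    g x * Real.exp (primitive f x)
      + 2 * funP f g x * (∫ s in (0 : ℝ)..x, Real.exp (primitive f s)) ≠ 0 := by
  have h1 := mul_pos (h.mul_g_pos hx hx0) (Real.exp_pos (primitive f x))
  have h2 := mul_pos (h.funP_pos hC hx) (h.mul_arclength_pos hx hx0)
  intro h3
  have : x * (g x * Real.exp (primitive f x)
      + 2 * funP f g x * (∫ s in (0 : ℝ)..x, Real.exp (primitive f s))) = 0 := by
    rw [h3, mul_zero]
  linarith

end IsCenterData

/-! ### Kepler's equation, polar angle and compact sublevel sets. -/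

/-- The solution `θ = Θ(t)` of Kepler's equation `k (a θ + c sin θ) = t`, where `|c| < a`. -/
theorem exists_kepler_solution {a c k : ℝ} (hk : 0 < k) (hpos : ∀ θ, 0 < a + c * Real.cos θ) :
    ∃ Θ : ℝ → ℝ, (∀ θ, Θ (k * (a * θ + c * Real.sin θ)) = θ) ∧
      (∀ t, k * (a * Θ t + c * Real.sin (Θ t)) = t) ∧
      ∀ t, HasDerivAt Θ (k * (a + c * Real.cos (Θ t)))⁻¹ t := by
  let K : ℝ → ℝ := fun θ => k * (a * θ + c * Real.sin θ)
  have hK : ∀ θ, HasDerivAt K (k * (a + c * Real.cos θ)) θ := fun θ => by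
    simpa using (((hasDerivAt_id θ).const_mul a).add
      ((Real.hasDerivAt_sin θ).const_mul c)).const_mul k
  have ha : 0 < a := by simpa using hpos (Real.pi / 2)
  obtain ⟨Θ, hΘ, hΘd⟩ := exists_inverse_of_hasDerivAt_pos isOpen_univ ordConnected_univ
    (fun θ _ => hK θ) (fun θ _ => mul_pos hk (hpos θ))
  have hKc : Continuous K := continuous_iff_continuousAt.2 fun θ => (hK θ).continuousAt
  -- The sine term is bounded and `a > 0`, so `K` tends to `±∞` at `±∞`.
  have hsurj : Function.Surjective K := by
    have hbound : ∀ θ, |c * Real.sin θ| ≤ |c| := fun θ => by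
      rw [abs_mul]
      exact mul_le_of_le_one_right (abs_nonneg c) (Real.abs_sin_le_one θ)
    refine hKc.surjective ?_ ?_
    · refine Tendsto.const_mul_atTop hk ?_
      refine tendsto_atTop_mono (f := fun θ => a * θ + -|c|)
        (fun θ => by linarith [neg_le_of_abs_le (hbound θ)]) ?_
      exact tendsto_atTop_add_const_right _ _ (tendsto_id.const_mul_atTop ha)
    · refine Tendsto.const_mul_atBot hk ?_
      refine tendsto_atBot_mono (f := fun θ => a * θ + |c|)
        (fun θ => by linarith [le_of_abs_le (hbound θ)]) ?_
      exact tendsto_atBot_add_const_right _ _ (tendsto_id.const_mul_atBot ha)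
  refine ⟨Θ, fun θ => hΘ θ (mem_univ θ), fun t => ?_, fun t => ?_⟩
  · obtain ⟨θ, rfl⟩ := hsurj t
    rw [hΘ θ (mem_univ θ)]
  · obtain ⟨θ, rfl⟩ := hsurj t
    rw [hΘ θ (mem_univ θ)]
    exact hΘd θ (mem_univ θ)

/-- The angle is the argument of `p + iq`; it serves to show that every point of a level curve lies
on the orbit. -/
theorem exists_angle_of_sq_add_sq {A p q : ℝ} (hA : 0 < A) (h : p ^ 2 + q ^ 2 = A ^ 2) :
    ∃ θ, A * Real.cos θ = p ∧ A * Real.sin θ = q := by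
  let w : ℂ := ⟨p, q⟩
  have hw : ‖w‖ = A := by
    rw [Complex.norm_def, Complex.normSq_apply, ← sq, ← sq, h, Real.sqrt_sq hA.le]
  refine ⟨w.arg, ?_, ?_⟩
  · rw [← hw, Complex.norm_mul_cos_arg]
  · rw [← hw, Complex.norm_mul_sin_arg]

/-- If a sublevel set of a function on an open set is compact, then the level is exceeded on both
sides of any point of the sublevel set. -/
theorem exists_lt_and_gt_of_isCompact_sublevel {φ : ℝ → ℝ} {E x : ℝ} (hI : IsOpen I)
    (hcomp : IsCompact {y | y ∈ I ∧ φ y ≤ E}) (hx : x ∈ I) (hxE : φ x ≤ E) :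
    (∃ y ∈ I, y < x ∧ E < φ y) ∧ ∃ y ∈ I, x < y ∧ E < φ y := by
  have hne : {y | y ∈ I ∧ φ y ≤ E}.Nonempty := ⟨x, hx, hxE⟩
  constructor
  · obtain ⟨m, hm, hmin⟩ := hcomp.exists_isLeast hne
    have hev : ∀ᶠ y in 𝓝[<] m, y ∈ I ∧ y < m :=
      Eventually.and (nhdsWithin_le_nhds (hI.mem_nhds hm.1)) self_mem_nhdsWithin
    obtain ⟨y, hyI, hym⟩ := hev.exists
    refine ⟨y, hyI, hym.trans_le (hmin ⟨hx, hxE⟩), ?_⟩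
    by_contra hle
    exact absurd (hmin ⟨hyI, not_lt.1 hle⟩) (not_le.2 hym)
  · obtain ⟨m, hm, hmax⟩ := hcomp.exists_isGreatest hne
    have hev : ∀ᶠ y in 𝓝[>] m, y ∈ I ∧ m < y :=
      Eventually.and (nhdsWithin_le_nhds (hI.mem_nhds hm.1)) self_mem_nhdsWithin
    obtain ⟨y, hyI, hym⟩ := hev.exists
    refine ⟨y, hyI, (hmax ⟨hx, hxE⟩).trans_lt hym, ?_⟩
    by_contra hle
    exact absurd (hmax ⟨hyI, not_lt.1 hle⟩) (not_le.2 hym)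

/-! ### Isochronicity. -/

namespace IsCenterData

/-- Under `(*)` the level curves are closed orbits, all of the same period. -/
theorem isIsochronous (h : IsCenterData f g I) (hC : ∀ x ∈ I, PCondition f g x) {Estar : ℝ}
    (hK : ∀ E ∈ Ioo 0 Estar, IsCompact {x | x ∈ I ∧ potential f g x ≤ E}) :
    IsIsochronous f g I Estar := by
  obtain ⟨a, b, z, ha, hz0, hz⟩ := h.exists_quadratic_coordinate hC
  have hsqrt : 0 < √a := Real.sqrt_pos.2 ha
  have hsq : √a ^ 2 = a := Real.sq_sqrt ha.le
  obtain ⟨X, hXz, hXd⟩ := exists_inverse_of_hasDerivAt_pos h.isOpen h.ordConnected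
    (fun x hx => (hz x hx).2.1)
    (fun x hx => div_pos (Real.exp_pos _) (mul_pos two_pos (hz x hx).1))
  have hzc : ContinuousOn z I := fun x hx => (hz x hx).2.1.continuousAt.continuousWithinAt
  have hzmono : StrictMonoOn z I := by
    refine strictMonoOn_of_deriv_pos h.ordConnected.convex hzc fun x hx => ?_
    have hx' := interior_subset hx
    rw [(hz x hx').2.1.deriv]
    exact div_pos (Real.exp_pos _) (mul_pos two_pos (hz x hx').1)
  -- As `P 0 * a³ = 1`, this period equals `2π / √(g' 0)`, that of the linearised equation.
  refine ⟨√a * (a * (2 * Real.pi)), fun E hE => ?_⟩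
  have hAa : 0 < E * a / 2 := by have := hE.1; positivity
  -- The amplitude in `z`: `V = E` exactly when `z² = E a / 2`.
  set A := √(E * a / 2) with hA_def
  have hA : 0 < A := Real.sqrt_pos.2 hAa
  have hA2 : A ^ 2 = E * a / 2 := Real.sq_sqrt hAa.le
  have hlarge : ∀ x ∈ I, E < potential f g x → A < |z x| := by
    intro x hx hEx
    refine lt_of_pow_lt_pow_left₀ 2 (abs_nonneg _) ?_
    rw [hA2, sq_abs]
    nlinarith [(hz x hx).2.2.2.2]
  -- Compactness of the sublevel set makes `V` exceed `E` on both sides of `0`, so the whole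
  -- oscillation range of `z` is attained inside `I`.
  have hcover : Icc (-A) A ⊆ z '' I := by
    obtain ⟨⟨y₁, hy₁, hlt₁, hE₁⟩, y₂, hy₂, hlt₂, hE₂⟩ := exists_lt_and_gt_of_isCompact_sublevel
      h.isOpen (hK E hE) h.zero_mem (by rw [potential_zero]; exact hE.1.le)
    have h1 := hlarge y₁ hy₁ hE₁
    have h2 := hlarge y₂ hy₂ hE₂
    rw [abs_of_neg (hz0 ▸ hzmono hy₁ h.zero_mem hlt₁)] at h1
    rw [abs_of_pos (hz0 ▸ hzmono h.zero_mem hy₂ hlt₂)] at h2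
    refine (Icc_subset_Icc (lt_neg_of_lt_neg h1).le h2.le).trans ?_
    exact (intermediate_value_Icc (hlt₁.trans hlt₂).le
      (hzc.mono (h.ordConnected.out hy₁ hy₂))).trans (image_mono (h.ordConnected.out hy₁ hy₂))
  have hcosmem : ∀ θ, ∃ x ∈ I, z x = A * Real.cos θ := fun θ =>
    hcover ⟨by nlinarith [Real.neg_one_le_cos θ], by nlinarith [Real.cos_le_one θ]⟩
  have hXmem : ∀ θ, X (A * Real.cos θ) ∈ I ∧ z (X (A * Real.cos θ)) = A * Real.cos θ := by
    intro θ
    obtain ⟨x, hx, hzx⟩ := hcosmem θ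
    rw [← hzx, hXz x hx]
    exact ⟨hx, rfl⟩
  have hspos : ∀ θ, 0 < a + b * A * Real.cos θ := by
    intro θ
    obtain ⟨x, hx, hzx⟩ := hcosmem θ
    rw [mul_assoc, ← hzx]
    exact (hz x hx).1
  obtain ⟨Θ, hΘK, hKΘ, hΘd⟩ := exists_kepler_solution hsqrt hspos
  let x : ℝ → ℝ := fun t => X (A * Real.cos (Θ t))
  -- Obtained from `z = A cos Θ`, `dz/dt = exp F * v / (2 s)` and `dΘ/dt = 1 / (√a s)`.
  let v : ℝ → ℝ := fun t => -(2 * A / √a) * Real.sin (Θ t) * Real.exp (-primitive f (x t))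
  have hxI : ∀ t, x t ∈ I := fun t => (hXmem (Θ t)).1
  have hzx : ∀ t, z (x t) = A * Real.cos (Θ t) := fun t => (hXmem (Θ t)).2
  have hdx : ∀ t, HasDerivAt x (v t) t := by
    intro t
    have h1 := hXd (x t) (hxI t)
    rw [hzx t] at h1
    refine (h1.comp t ((hΘd t).cos.const_mul A)).congr_deriv ?_
    have h2 := hspos (Θ t)
    simp only [v, Real.exp_neg, ← mul_assoc]
    have h3 := Real.exp_pos (primitive f (x t))
    field_simp
  -- A full turn leaves the sine term of Kepler's equation unchanged; only `√a * a * 2π` is added to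
  -- the time, whatever the value of `A`.
  have hΘshift : ∀ t, Θ (t + √a * (a * (2 * Real.pi))) = Θ t + 2 * Real.pi := by
    intro t
    rw [← hΘK (Θ t + 2 * Real.pi), Real.sin_add_two_pi]
    congr 1
    linear_combination -hKΘ t
  have hΘ0 : Θ 0 = 0 := by simpa using hΘK 0
  refine ⟨x, v, fun t => ⟨hdx t, ?_⟩, ?_, by positivity, fun t => ?_, fun T' hT' hper => ?_⟩
  · have hF := (h.hasDerivAt_primitive (hxI t)).comp t (hdx t)
    have hD := ((hΘd t).sin.const_mul (-(2 * A / √a))).fun_mul hF.fun_neg.exp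
    refine hD.congr_deriv ?_
    obtain ⟨-, -, -, hg, -⟩ := hz (x t) (hxI t)
    rw [hzx t, ← mul_assoc b] at hg
    have hs := hspos (Θ t)
    have he := Real.exp_pos (primitive f (x t))
    have hg' : g (x t) = 2 * (A * Real.cos (Θ t))
        / (Real.exp (primitive f (x t)) * (√a ^ 2 * (a + b * A * Real.cos (Θ t)))) := by
      rw [hsq, eq_div_iff (mul_pos he (mul_pos ha hs)).ne']
      linear_combination hg
    rw [hg']
    simp only [v, Function.comp_apply, Real.exp_neg]
    field_simp
    ring
  · ext ⟨p, q⟩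
    constructor
    · rintro ⟨t, ht⟩
      obtain ⟨rfl, rfl⟩ := Prod.mk.inj ht
      refine ⟨hxI t, ?_⟩
      obtain ⟨-, -, -, -, hV⟩ := hz (x t) (hxI t)
      rw [hzx t] at hV
      have hV' : potential f g (x t) = E * Real.cos (Θ t) ^ 2 := by
        refine mul_left_cancel₀ ha.ne' ?_
        linear_combination hV + 2 * Real.cos (Θ t) ^ 2 * hA2
      have he := Real.exp_pos (primitive f (x t))
      have hT : mass f (x t) * v t ^ 2 / 2 = E * Real.sin (Θ t) ^ 2 := by
        simp only [mass_eq, v, Real.exp_neg]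
        field_simp
        rw [hsq, hA2]
        ring
      change mass f (x t) * v t ^ 2 / 2 + potential f g (x t) = E
      rw [hT, hV']
      linear_combination E * Real.sin_sq_add_cos_sq (Θ t)
    · rintro ⟨hp, hE'⟩
      change p ∈ I at hp
      change mass f p * q ^ 2 / 2 + potential f g p = E at hE'
      rw [mass_eq] at hE'
      -- Energy conservation as a circle of radius `A`; the second coordinate is `A sin θ` as read
      -- off from the formula for `v`.
      have hcirc : z p ^ 2 + (-(q * Real.exp (primitive f p) * √a / 2)) ^ 2 = A ^ 2 := by
        have hV := (hz p hp).2.2.2.2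
        rw [hA2, neg_sq, div_pow, mul_pow, mul_pow, hsq]
        linear_combination (a / 2) * hE' - hV / 2
      obtain ⟨θ, hcos, hsin⟩ := exists_angle_of_sq_add_sq hA hcirc
      refine ⟨√a * (a * θ + b * A * Real.sin θ), Prod.ext ?_ ?_⟩
      · change X (A * Real.cos (Θ _)) = p
        rw [hΘK, hcos, hXz p hp]
      · change -(2 * A / √a) * Real.sin (Θ _)
          * Real.exp (-primitive f (X (A * Real.cos (Θ _)))) = q
        rw [hΘK, hcos, hXz p hp, Real.exp_neg]
        have he := Real.exp_pos (primitive f p)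
        field_simp
        linear_combination -2 * hsin
  · have : x (t + √a * (a * (2 * Real.pi))) = x t := by
      simp only [x, hΘshift, Real.cos_add_two_pi]
    simp only [v, this, hΘshift, Real.sin_add_two_pi]
  -- Minimality: returning to the starting position, where `z = A`, forces `cos (Θ T') = 1`. Then `Θ
  -- T'` is a multiple of `2π`, so `T'` is a positive integer multiple of the period.
  · have h1 : x T' = x 0 := by
      have := hper 0
      rw [zero_add] at this
      exact (Prod.mk.inj this).1
    have h2 : Real.cos (Θ T') = 1 := by
      have h3 := hzx T'
      rw [h1, hzx 0, hΘ0, Real.cos_zero] at h3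
      exact (mul_left_cancel₀ hA.ne' h3).symm
    obtain ⟨n, hn⟩ := (Real.cos_eq_one_iff _).1 h2
    have hT := hKΘ T'
    have hsin : Real.sin (n * (2 * Real.pi)) = 0 := by
      simpa using Real.sin_int_mul_two_pi_sub 0 n
    rw [← hn, hsin, mul_zero, add_zero] at hT
    have hpi := Real.pi_pos
    have hc : 0 < √a * (a * (2 * Real.pi)) := by positivity
    have hn' : T' = n * (√a * (a * (2 * Real.pi))) := by linear_combination -hT
    have hnpos : (0 : ℝ) < n := by
      rw [hn'] at hT'
      exact pos_of_mul_pos_left hT' hc.le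
    have hn1 : (1 : ℝ) ≤ n := by exact_mod_cast Int.cast_pos.1 hnpos
    rw [hn']
    exact le_mul_of_one_le_left hc.le hn1

theorem pCondition_of_funP_eq_one (h : IsCenterData f g I) (hP : ∀ x ∈ I, funP f g x = 1)
    {x : ℝ} (hx : x ∈ I) : PCondition f g x := by
  have hd : ∀ y ∈ I, deriv (funP f g) y = 0 := by
    intro y hy
    have hev : funP f g =ᶠ[𝓝 y] fun _ => 1 := by
      filter_upwards [h.isOpen.mem_nhds hy] with w hw using hP w hw
    rw [hev.deriv_eq, deriv_const]
  have hev : deriv (funP f g) =ᶠ[𝓝 x] fun _ => 0 := by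
    filter_upwards [h.isOpen.mem_nhds hx] with w hw using hd w hw
  rw [PCondition, hd x hx, hev.deriv_eq, deriv_const]
  ring

end IsCenterData

end LienardII

theorem proposition3p1 (f g : ℝ → ℝ) (I : Set ℝ) (hIopen : IsOpen I) (hIconn : I.OrdConnected)
    (h0 : (0 : ℝ) ∈ I) (hf : ContDiffOn ℝ 2 f I) (hg : ContDiffOn ℝ 3 g I)
    (hg0 : g 0 = 0) (hg0' : 0 < deriv g 0) (hgne : ∀ x ∈ I, x ≠ 0 → g x ≠ 0)
    (Estar : ℝ) (hEstar : 0 < Estar)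
    (hK : ∀ E ∈ Set.Ioo 0 Estar, IsCompact {x | x ∈ I ∧ LienardII.potential f g x ≤ E}) :
    ((∀ x ∈ I, x ≠ 0 → LienardII.funN f g x = 0) ↔ ∀ x ∈ I, LienardII.PCondition f g x) ∧
    ((∀ x ∈ I, LienardII.PCondition f g x) →
      (∀ x ∈ I, 3 * (LienardII.funP f g x) ^ 2 - g x * deriv (LienardII.funP f g) x ≠ 0) ∧
      (∀ x ∈ I, x ≠ 0 →
        g x * Real.exp (LienardII.primitive f x)
          + 2 * LienardII.funP f g x
            * (∫ s in (0 : ℝ)..x, Real.exp (LienardII.primitive f s)) ≠ 0)) ∧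
    ((∀ x ∈ I, LienardII.PCondition f g x) → LienardII.IsIsochronous f g I Estar) ∧
    ((∀ x ∈ I, LienardII.funP f g x = 1) →
      (∀ x ∈ I, x ≠ 0 → LienardII.funN f g x = 0) ∧ LienardII.IsIsochronous f g I Estar) := by
  have h : LienardII.IsCenterData f g I := ⟨hIopen, hIconn, h0, hf, hg, hg0, hg0', hgne⟩
  refine ⟨h.funN_eq_zero_iff_pCondition, fun hC => ⟨fun x hx => ?_, fun x hx hx0 => ?_⟩,
    fun hC => h.isIsochronous hC hK, fun hP => ?_⟩
  · exact (h.three_mul_sq_sub_pos hC hx).1.ne'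
  · exact h.mul_exp_add_ne_zero hC hx hx0
  · have hC := fun x (hx : x ∈ I) => h.pCondition_of_funP_eq_one hP hx
    exact ⟨h.funN_eq_zero_iff_pCondition.2 hC, h.isIsochronous hC hK⟩
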